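/- **Comparison theorem.** Let $a<b$, $\Delta=[a,b]$, $0<\mu\le 1$, $0\le\nu\le 1$, $\varepsilon=\mu+\nu(1-\mu)$ and $\xi>0$. Let $\Psi\in C^1(\Delta,\mathbb R)$ be increasing with $\Psi'(t)\ne 0$ on $\Delta$. For $\alpha>0$ put $$\mathbf I_{a^+}^{\alpha;\Psi}x(t)=\frac1{\Gamma(\alpha)}\int_a^t\Psi'(s)(\Psi(t)-\Psi(s))^{\alpha-1}x(s)\,ds,\qquad \mathbf I_{a^+}^{0;\Psi}x=x,$$ and define the $\Psi$-Hilfer derivative of order $\mu$ and type $\nu$ by $${}^{\mathbf H}\mathfrak D_{a^+}^{\mu,\nu;\Psi}x(t)=\mathbf I_{a^+}^{\nu(1-\mu);\Psi}\Big(\frac1{\Psi'(t)}\frac{d}{dt}\Big)\mathbf I_{a^+}^{(1-\nu)(1-\mu);\Psi}x(t).$$ Let $C_{\xi,\mu,\Psi}(\Delta,\mathbb R)$ be the space of continuous $x:\Delta\to\mathbb R$ with $\sup_{t\in\Delta}|x(t)|/E_\mu(\xi(\Psi(t)-\Psi(a))^\mu)<\infty$, where $E_\mu(z)=\sum_{k\ge0}z^k/\Gamma(\mu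 k+1)$, ordered pointwise. For $i=1,2,3$ let $f_i:\Delta\times\mathbb R\to\mathbb R$ be continuous and let $\mathcal U_i:C_{\xi,\mu,\Psi}(\Delta,\mathbb R)\to C_{\xi,\mu,\Psi}(\Delta,\mathbb R)$ be an abstract Volterra operator (if $x=y$ on $[a,t]$, then $\mathcal U_i(x)=\mathcal U_i(y)$ on $[a,t]$). Assume that for each $i$ there are $L_{f_i}>0$ and $L_{\mathcal U_i}>0$ with $L_{\mathcal U_i}+L_{f_i}<\xi$ such that $$|f_i(t,u)-f_i(t,v)|\le L_{f_i}|u-v|,\qquad |\mathcal U_i(x)(t)-\mathcal U_i(y)(t)|\le L_{\mathcal U_i}|x(t)-y(t)|$$ for all $t\in\Delta$, $u,v\in\mathbb R$ and $x,y\in C_{\xi,\mu,\Psi}(\Delta,\mathbb R)$. Suppose that (a) $f_1\le f_2\le f_3$ on $\Delta\times\mathbb R$, and $\mathcal U_1(x)\le\mathcal U_2(x)\le\mathcal U_3(x)$ on $\Delta$ for every $x\in C_{\xi,\mu,\Psi}(\Delta,\mathbb R)$; (b) $f_2(t,\cdot)$ is (weakly) increasing for every $t\in\Delta$; (c) $\mathcal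 U_2$ is (weakly) increasing; (d) for $i=1,2,3$, $x_i\in C_{\xi,\mu,\Psi}(\Delta,\mathbb R)$ has a $\Psi$-Hilfer derivative at every point of $(a,b]$ (that is, the inner fractional integral is differentiable there and both fractional integrals converge absolutely; this is so if $x_i$ is $C^1$ on $\Delta$), and $${}^{\mathbf H}\mathfrak D_{a^+}^{\mu,\nu;\Psi}x_i(t)=\mathcal U_i(x_i)(t)+f_i(t,x_i(t)),\qquad t\in(a,b].$$ Write $\mathbf I_{a^+}^{1-\varepsilon;\Psi}x_i(a)$ for $\lim_{t\to a^+}\mathbf I_{a^+}^{1-\varepsilon;\Psi}x_i(t)$. If $$\mathbf I_{a^+}^{1-\varepsilon;\Psi}x_1(a)\le\mathbf I_{a^+}^{1-\varepsilon;\Psi}x_2(a)\le\mathbf I_{a^+}^{1-\varepsilon;\Psi}x_3(a),$$ then $x_1(t)\le x_2(t)\le x_3(t)$ for all $t\in\Delta$. -/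

import Mathlib

open Set Filter Topology

noncomputable section

namespace PsiHilfer

/-- The one-parameter Mittag-Leffler function `E_μ(z) = ∑ z ^ k / Γ(μ k + 1)`. -/
def mittagLeffler (μ z : ℝ) : ℝ :=
  ∑' k : ℕ, z ^ k / Real.Gamma (μ * k + 1)

/-- The weight `E_μ(ξ (Ψ(t) - Ψ(a)) ^ μ)` of the Bielecki-type norm. -/
def bieleckiWeight (a ξ μ : ℝ) (Ψ : ℝ → ℝ) (t : ℝ) : ℝ :=
  mittagLeffler μ (ξ * (Ψ t - Ψ a) ^ μ)

/-- The space `C_{ξ,μ,Ψ}([a,b],ℝ)`: continuous functions `x` on `[a,b]` such that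
`sup_t |x(t)| / E_μ(ξ (Ψ(t) - Ψ(a)) ^ μ)` is finite; it is ordered pointwise. -/
abbrev BieleckiSpace (a b ξ μ : ℝ) (Ψ : ℝ → ℝ) : Type :=
  {x : C(Icc a b, ℝ) //
    BddAbove (range fun t : Icc a b => |x t| / bieleckiWeight a ξ μ Ψ (t : ℝ))}

/-- The kernel `Ψ'(s) (Ψ(t) - Ψ(s)) ^ (α - 1)`, where `Ψ'` is the derivative on `[a,b]`. -/
def kernel (a b : ℝ) (Ψ : ℝ → ℝ) (α t s : ℝ) : ℝ :=
  derivWithin Ψ (Icc a b) s * (Ψ t - Ψ s) ^ (α - 1)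

/-- The left-sided Riemann-Liouville integral of order `α ≥ 0` with respect to `Ψ`,
`(1 / Γ(α)) ∫_a^t Ψ'(s) (Ψ(t) - Ψ(s)) ^ (α - 1) x(s) ds`; order `0` is the identity. -/
def fracInt (a b : ℝ) (Ψ : ℝ → ℝ) (α : ℝ) (x : ℝ → ℝ) (t : ℝ) : ℝ :=
  if α = 0 then x t
  else (1 / Real.Gamma α) * ∫ s in a..t, kernel a b Ψ α t s * x s

/-- The integral defining `fracInt a b Ψ α x t` converges absolutely (no condition at order `0`). -/
def FracIntegrable (a b : ℝ) (Ψ : ℝ → ℝ) (α : ℝ) (x : ℝ → ℝ) (t : ℝ) : Prop :=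
  α ≠ 0 → IntervalIntegrable (fun s => kernel a b Ψ α t s * x s) MeasureTheory.volume a t

/-- `(1 / Ψ'(t)) d/dt` on `[a,b]`. -/
def psiDeriv (a b : ℝ) (Ψ : ℝ → ℝ) (y : ℝ → ℝ) (t : ℝ) : ℝ :=
  (1 / derivWithin Ψ (Icc a b) t) * derivWithin y (Icc a b) t

/-- The `Ψ`-Hilfer derivative of order `μ ∈ (0,1]` and type `ν`,
`I^{ν(1-μ);Ψ} ((1 / Ψ') d/dt) I^{(1-ν)(1-μ);Ψ} x`. -/
def hilferDeriv (a b : ℝ) (Ψ : ℝ → ℝ) (μ ν : ℝ) (x : ℝ → ℝ) (t : ℝ) : ℝ :=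
  fracInt a b Ψ (ν * (1 - μ))
    (psiDeriv a b Ψ (fracInt a b Ψ ((1 - ν) * (1 - μ)) x)) t

/-- The `Ψ`-Hilfer derivative of `x` exists on `(a,b]`: both fractional integrals converge
absolutely and the inner one is differentiable. -/
structure HilferDifferentiable (a b : ℝ) (Ψ : ℝ → ℝ) (μ ν : ℝ) (x : ℝ → ℝ) : Prop where
  inner_integrable : ∀ t ∈ Ioc a b, FracIntegrable a b Ψ ((1 - ν) * (1 - μ)) x t
  inner_differentiable : ∀ t ∈ Ioc a b,
    DifferentiableWithinAt ℝ (fracInt a b Ψ ((1 - ν) * (1 - μ)) x) (Icc a b) t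
  outer_integrable : ∀ t ∈ Ioc a b,
    FracIntegrable a b Ψ (ν * (1 - μ))
      (psiDeriv a b Ψ (fracInt a b Ψ ((1 - ν) * (1 - μ)) x)) t

/-- Abstract Volterra (causal) operators: the values of `U x` on `[a,t]` depend only on the
values of `x` on `[a,t]`. -/
def IsAbstractVolterra {a b ξ μ : ℝ} {Ψ : ℝ → ℝ}
    (U : BieleckiSpace a b ξ μ Ψ → BieleckiSpace a b ξ μ Ψ) : Prop :=
  ∀ (t : Icc a b) (x y : BieleckiSpace a b ξ μ Ψ),
    (∀ s ≤ t, x.1 s = y.1 s) → ∀ s ≤ t, (U x).1 s = (U y).1 s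

/-- The Lipschitz conditions on `f` and on the abstract Volterra operator `U`. -/
def LipschitzConditions {a b ξ μ : ℝ} {Ψ : ℝ → ℝ} (f : Icc a b → ℝ → ℝ)
    (U : BieleckiSpace a b ξ μ Ψ → BieleckiSpace a b ξ μ Ψ) : Prop :=
  IsAbstractVolterra U ∧
  ∃ Lf > 0, ∃ LU > 0, LU + Lf < ξ ∧
    (∀ t u v, |f t u - f t v| ≤ Lf * |u - v|) ∧
    (∀ x y t, |(U x).1 t - (U y).1 t| ≤ LU * |x.1 t - y.1 t|)

/-- `x ∈ C_{ξ,μ,Ψ}([a,b],ℝ)` solves `D^{μ,ν;Ψ} x(t) = U(x)(t) + f(t,x(t))`: the derivative exists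
on `(a,b]` and the equation holds there.  At `t = a` the fractional integral degenerates, so no
equation is imposed.  The extension of `x` to `ℝ` only serves to write the integrals. -/
def IsSolution {a b ξ μ : ℝ} {Ψ : ℝ → ℝ} (hab : a ≤ b) (ν : ℝ) (f : Icc a b → ℝ → ℝ)
    (U : BieleckiSpace a b ξ μ Ψ → BieleckiSpace a b ξ μ Ψ)
    (x : BieleckiSpace a b ξ μ Ψ) : Prop :=
  HilferDifferentiable a b Ψ μ ν (IccExtend hab x.1) ∧
  ∀ t : Icc a b, a < (t : ℝ) →
    hilferDeriv a b Ψ μ ν (IccExtend hab x.1) t = (U x).1 t + f t (x.1 t)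

/-- `c` is the initial value `I^{1-ε;Ψ} x(a)`, `ε = μ + ν (1 - μ)`, as the limit at `a+`. -/
def HasInitialValue {a b ξ μ : ℝ} {Ψ : ℝ → ℝ} (hab : a ≤ b) (ν : ℝ)
    (x : BieleckiSpace a b ξ μ Ψ) (c : ℝ) : Prop :=
  Tendsto (fracInt a b Ψ (1 - (μ + ν * (1 - μ))) (IccExtend hab x.1)) (𝓝[>] a) (𝓝 c)

end PsiHilfer

end

/-! Put `α = (1-ν)(1-μ)`, `β = ν(1-μ)`, so that `1-ε = α` and `1-β = α+μ`. The substitution `u =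
Ψ(s)` turns every `Ψ`-integral into a classical Riemann-Liouville integral with base point `Ψ a`.

Let `h` be the right-hand side along a solution `x` with initial value `c`. Applying `I^{1-β}` to
the equation cancels the outer `I^β` by the semigroup law and integrates the inner derivative, so
`I^α x = c + I^{α+μ} h`. If `α = 0` this is `x = c + I^μ h`. If `α > 0`, boundedness of `x` forces
`c = 0`, and injectivity of `I^α` gives `x = I^μ h`. Thus `x = c + I^μ h` always
(`eq_add_rlInt_of_hilferDeriv_eq`).

For two neighbouring solutions let `w` be the positive part of the difference that should be
nonpositive. Monotonicity and the Lipschitz bounds of the middle right-hand side bound the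
difference of the right-hand sides by `L * w` (`sub_le_mul_max_of_monotone`), hence `w ≤ L * I^μ w`,
and a fractional Gronwall argument gives `w = 0` (`eq_zero_of_le_mul_rlInt`). -/

noncomputable section

namespace PsiHilfer

open MeasureTheory

/-! ### Riemann-Liouville integrals: Beta integral, semigroup law, continuity -/

/-- The Riemann-Liouville integral of order `α` with base point `A`. -/
def rlInt (A α : ℝ) (X : ℝ → ℝ) (t : ℝ) : ℝ :=
  (1 / Real.Gamma α) * ∫ u in A..t, (t - u) ^ (α - 1) * X u

theorem integral_sub_rpow_mul_sub_rpow {p q u t : ℝ} (hp : 0 < p) (hq : 0 < q) (hut : u < t) :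
    ∫ s in u..t, (t - s) ^ (p - 1) * (s - u) ^ (q - 1) =
      (t - u) ^ (p + q - 1) * (Real.Gamma p * Real.Gamma q / Real.Gamma (p + q)) := by
  have h1 : ∫ s in u..t, (t - s) ^ (p - 1) * (s - u) ^ (q - 1) =
      ∫ s in (0 : ℝ)..(t - u), s ^ (p - 1) * ((t - u) - s) ^ (q - 1) := by
    have := intervalIntegral.integral_comp_sub_left
      (fun s : ℝ => s ^ (p - 1) * ((t - u) - s) ^ (q - 1)) t (a := u) (b := t)
    rw [sub_self] at this
    rw [← this]
    refine intervalIntegral.integral_congr fun s _ => ?_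
    congr 2
    ring
  have h2 := Complex.betaIntegral_scaled (p : ℂ) (q : ℂ) (sub_pos.2 hut)
  rw [Complex.betaIntegral_eq_Gamma_mul_div _ _ (by simpa) (by simpa)] at h2
  rw [h1]
  apply Complex.ofReal_injective
  rw [← intervalIntegral.integral_ofReal]
  have h3 : ∫ s in (0 : ℝ)..(t - u), ((s ^ (p - 1) * ((t - u) - s) ^ (q - 1) : ℝ) : ℂ) =
      ∫ s in (0 : ℝ)..(t - u), (s : ℂ) ^ ((p : ℂ) - 1) * (((t - u : ℝ) : ℂ) - s) ^ ((q : ℂ) - 1) := by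
    refine intervalIntegral.integral_congr fun s hs => ?_
    rw [uIcc_of_le (sub_pos.2 hut).le] at hs
    rw [Complex.ofReal_mul, Complex.ofReal_cpow hs.1, Complex.ofReal_cpow (sub_nonneg.2 hs.2)]
    push_cast
    rfl
  rw [h3, h2]
  rw [Complex.ofReal_mul, Complex.ofReal_cpow (sub_pos.2 hut).le, Complex.ofReal_div,
    Complex.ofReal_mul, ← Complex.Gamma_ofReal, ← Complex.Gamma_ofReal, ← Complex.Gamma_ofReal]
  push_cast
  rfl

/-- A non-integrable function has integral `0` by convention, whereas the Beta value is positive. -/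
theorem intervalIntegrable_sub_rpow_mul_sub_rpow {p q u t : ℝ} (hp : 0 < p) (hq : 0 < q)
    (hut : u < t) :
    IntervalIntegrable (fun s => (t - s) ^ (p - 1) * (s - u) ^ (q - 1)) volume u t := by
  by_contra h
  have h1 := intervalIntegral.integral_undef h
  rw [integral_sub_rpow_mul_sub_rpow hp hq hut] at h1
  have := Real.Gamma_pos_of_pos hp
  have := Real.Gamma_pos_of_pos hq
  have := Real.Gamma_pos_of_pos (add_pos hp hq)
  have := Real.rpow_pos_of_pos (sub_pos.2 hut) (p + q - 1)
  exact absurd h1 (by positivity)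

theorem intervalIntegrable_sub_rpow {α : ℝ} (hα : 0 < α) (A t : ℝ) :
    IntervalIntegrable (fun u => (t - u) ^ (α - 1)) volume A t := by
  have h := (intervalIntegral.intervalIntegrable_rpow' (a := 0) (b := t - A) (r := α - 1)
    (by linarith)).comp_sub_left t
  simpa using h.symm

theorem intervalIntegrable_sub_rpow_mul {α : ℝ} (hα : 0 < α) (A t : ℝ) {X : ℝ → ℝ}
    (hX : Continuous X) :
    IntervalIntegrable (fun u => (t - u) ^ (α - 1) * X u) volume A t :=
  (intervalIntegrable_sub_rpow hα A t).mul_continuousOn hX.continuousOn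

theorem intervalIntegrable_of_sub_rpow_mul {A β T : ℝ} {G : ℝ → ℝ} (hβ : β ≤ 1) (hAT : A ≤ T)
    (h : IntervalIntegrable (fun u => (T - u) ^ (β - 1) * G u) volume A T) :
    IntervalIntegrable G volume A T := by
  have hc : ContinuousOn (fun u : ℝ => (T - u) ^ (1 - β)) (uIcc A T) :=
    ((continuous_const.sub continuous_id).rpow_const fun _ =>
      Or.inr (sub_nonneg.2 hβ)).continuousOn
  have h1 := h.continuousOn_mul hc
  -- The two powers of `T - u` cancel only for `u < T`, hence the open interval.
  rw [intervalIntegrable_iff_integrableOn_Ioo_of_le hAT] at h1 ⊢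
  refine h1.congr_fun (fun u hu => ?_) measurableSet_Ioo
  have hpos : 0 < T - u := sub_pos.2 hu.2
  change (T - u) ^ (1 - β) * ((T - u) ^ (β - 1) * G u) = G u
  rw [← mul_assoc, ← Real.rpow_add hpos, show 1 - β + (β - 1) = 0 by ring, Real.rpow_zero, one_mul]

/-- The semigroup property of Riemann-Liouville integrals. -/
theorem rlInt_rlInt {A p q t : ℝ} {X : ℝ → ℝ} (hp : 0 < p) (hq : 0 < q) (hAt : A ≤ t)
    (hXm : AEStronglyMeasurable X (volume.restrict (Ioc A t)))
    (hX : IntervalIntegrable (fun u => (t - u) ^ (p + q - 1) * X u) volume A t) :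
    rlInt A p (rlInt A q X) t = rlInt A (p + q) X t := by
  set m := volume.restrict (Ioc A t) with hm
  -- The integrand on the triangle `A < u < s`, extended by zero to the square so that Fubini
  -- applies. Integrating out `s` leaves a Beta integral.
  set F : ℝ → ℝ → ℝ := fun s u =>
    (Ioo A s).indicator (fun u => (t - s) ^ (p - 1) * (s - u) ^ (q - 1) * X u) u with hF
  have hFm : AEStronglyMeasurable (Function.uncurry F) (m.prod m) := by
    have h1 : Function.uncurry F = {z : ℝ × ℝ | A < z.2 ∧ z.2 < z.1}.indicator
        (fun z => (t - z.1) ^ (p - 1) * (z.1 - z.2) ^ (q - 1) * X z.2) := by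
      funext z
      simp only [Function.uncurry, hF, indicator, mem_Ioo, mem_ofPred_eq]
    rw [h1]
    refine AEStronglyMeasurable.indicator ?_ ?_
    · refine AEStronglyMeasurable.mul ?_ hXm.comp_snd
      exact Measurable.aestronglyMeasurable (by fun_prop)
    · exact (measurableSet_lt measurable_const measurable_snd).inter
        (measurableSet_lt measurable_snd measurable_fst)
  have hsec : ∀ u ∈ Ioo A t, ∀ (c : ℝ), (Ioc A t).indicator
      (fun s => (Ioo A s).indicator (fun u => (t - s) ^ (p - 1) * (s - u) ^ (q - 1) * c) u) =
      (Ioc u t).indicator (fun s => (t - s) ^ (p - 1) * (s - u) ^ (q - 1) * c) := by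
    intro u hu c
    funext s
    simp only [indicator, mem_Ioo, mem_Ioc]
    have := hu.1
    split_ifs <;> first | rfl | (exfalso; grind)
  have hint : ∀ u ∈ Ioo A t, ∀ c : ℝ, ∫ s, (Ioo A s).indicator
      (fun u => (t - s) ^ (p - 1) * (s - u) ^ (q - 1) * c) u ∂m =
      (t - u) ^ (p + q - 1) * (Real.Gamma p * Real.Gamma q / Real.Gamma (p + q)) * c := by
    intro u hu c
    rw [hm, ← integral_indicator measurableSet_Ioc, hsec u hu, integral_indicator measurableSet_Ioc,
      ← intervalIntegral.integral_of_le hu.2.le, intervalIntegral.integral_mul_const,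
      integral_sub_rpow_mul_sub_rpow hp hq hu.2]
  have hae : ∀ᵐ u ∂m, u ∈ Ioo A t := by
    rw [hm, ← restrict_Ioo_eq_restrict_Ioc]
    exact ae_restrict_mem measurableSet_Ioo
  have hX' : Integrable (fun u => (t - u) ^ (p + q - 1) * X u) m :=
    (intervalIntegrable_iff_integrableOn_Ioc_of_le hAt).1 hX
  have hFi : Integrable (Function.uncurry F) (m.prod m) := by
    rw [integrable_prod_iff' hFm]
    constructor
    · filter_upwards [hae] with u hu
      have h5 : (fun s => Function.uncurry F (s, u)) = fun s => (Ioo A s).indicator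
          (fun u' => (t - s) ^ (p - 1) * (s - u') ^ (q - 1) * X u) u := rfl
      rw [h5, hm, ← IntegrableOn, ← integrable_indicator_iff measurableSet_Ioc, hsec u hu,
        integrable_indicator_iff measurableSet_Ioc,
        ← intervalIntegrable_iff_integrableOn_Ioc_of_le hu.2.le]
      exact (intervalIntegrable_sub_rpow_mul_sub_rpow hp hq hu.2).mul_const _
    · refine (hX'.norm.const_mul (Real.Gamma p * Real.Gamma q / Real.Gamma (p + q))).congr ?_
      filter_upwards [hae] with u hu
      have h2 : ∫ s, ‖Function.uncurry F (s, u)‖ ∂m = ∫ s, (Ioo A s).indicator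
          (fun u => (t - s) ^ (p - 1) * (s - u) ^ (q - 1) * ‖X u‖) u ∂m := by
        refine integral_congr_ae ?_
        filter_upwards [hae] with s hs
        simp only [Function.uncurry, hF, indicator, mem_Ioo]
        split_ifs with h
        · rw [norm_mul, norm_mul, Real.norm_of_nonneg (Real.rpow_nonneg (by linarith [hs.2]) _),
            Real.norm_of_nonneg (Real.rpow_nonneg (by linarith [h.2]) _)]
        · simp
      have h3 := hint u hu ‖X u‖
      rw [h2]
      refine Eq.trans ?_ h3.symm
      rw [norm_mul, Real.norm_of_nonneg (Real.rpow_nonneg (by linarith [hu.2]) _)]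
      ring
  have hswap := integral_integral_swap hFi
  have hl : ∫ s, ∫ u, F s u ∂m ∂m =
      ∫ s in A..t, (t - s) ^ (p - 1) * ∫ u in A..s, (s - u) ^ (q - 1) * X u := by
    rw [intervalIntegral.integral_of_le hAt]
    refine integral_congr_ae ?_
    filter_upwards [hae] with s hs
    simp only [hF]
    rw [integral_indicator measurableSet_Ioo, hm, Measure.restrict_restrict measurableSet_Ioo,
      inter_eq_self_of_subset_left (Ioo_subset_Ioc_self.trans (Ioc_subset_Ioc_right hs.2.le)),
      ← integral_Ioc_eq_integral_Ioo, ← intervalIntegral.integral_of_le hs.1.le,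
      ← intervalIntegral.integral_const_mul]
    simp only [mul_assoc]
  have hr : ∫ u, ∫ s, F s u ∂m ∂m =
      (Real.Gamma p * Real.Gamma q / Real.Gamma (p + q)) *
        ∫ u in A..t, (t - u) ^ (p + q - 1) * X u := by
    rw [intervalIntegral.integral_of_le hAt, ← integral_const_mul]
    refine integral_congr_ae ?_
    filter_upwards [hae] with u hu
    have h3 := hint u hu (X u)
    refine Eq.trans h3 ?_
    ring
  rw [hl, hr] at hswap
  have hgp := (Real.Gamma_pos_of_pos hp).ne'
  have hgq := (Real.Gamma_pos_of_pos hq).ne'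
  have hgpq := (Real.Gamma_pos_of_pos (add_pos hp hq)).ne'
  have h4 : ∫ s in A..t, (t - s) ^ (p - 1) * rlInt A q X s = (1 / Real.Gamma q) *
      ∫ s in A..t, (t - s) ^ (p - 1) * ∫ u in A..s, (s - u) ^ (q - 1) * X u := by
    rw [← intervalIntegral.integral_const_mul]
    refine intervalIntegral.integral_congr fun s _ => ?_
    simp only [rlInt]
    ring
  rw [rlInt, h4, hswap, rlInt]
  field_simp

theorem rlInt_rlInt_of_continuous {A p q t : ℝ} {X : ℝ → ℝ} (hp : 0 < p) (hq : 0 < q) (hAt : A ≤ t)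
    (hX : Continuous X) : rlInt A p (rlInt A q X) t = rlInt A (p + q) X t :=
  rlInt_rlInt hp hq hAt hX.aestronglyMeasurable
    (intervalIntegrable_sub_rpow_mul (add_pos hp hq) A t hX)

theorem rlInt_one (A : ℝ) (X : ℝ → ℝ) (t : ℝ) : rlInt A 1 X t = ∫ u in A..t, X u := by
  simp [rlInt]

theorem rlInt_congr {A α t : ℝ} {X Y : ℝ → ℝ} (h : ∀ u ∈ Ioc A t, X u = Y u) (hAt : A ≤ t) :
    rlInt A α X t = rlInt A α Y t := by
  rw [rlInt, rlInt]
  congr 1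
  refine intervalIntegral.integral_congr_ae (Eventually.of_forall fun u hu => ?_)
  rw [uIoc_of_le hAt] at hu
  rw [h u hu]

theorem rlInt_sub {A α t : ℝ} {X Y : ℝ → ℝ} (hα : 0 < α) (hX : Continuous X) (hY : Continuous Y) :
    rlInt A α (fun u => X u - Y u) t = rlInt A α X t - rlInt A α Y t := by
  simp only [rlInt]
  rw [← mul_sub, ← intervalIntegral.integral_sub (intervalIntegrable_sub_rpow_mul hα A t hX)
    (intervalIntegrable_sub_rpow_mul hα A t hY)]
  simp only [mul_sub]

theorem rlInt_mono {A α t : ℝ} {X Y : ℝ → ℝ} (hα : 0 < α) (hAt : A ≤ t) (hX : Continuous X)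
    (hY : Continuous Y) (h : ∀ u ∈ Icc A t, X u ≤ Y u) : rlInt A α X t ≤ rlInt A α Y t := by
  refine mul_le_mul_of_nonneg_left ?_ (one_div_nonneg.2 (Real.Gamma_pos_of_pos hα).le)
  refine intervalIntegral.integral_mono_on hAt (intervalIntegrable_sub_rpow_mul hα A t hX)
    (intervalIntegrable_sub_rpow_mul hα A t hY) fun u hu => ?_
  exact mul_le_mul_of_nonneg_left (h u hu) (Real.rpow_nonneg (sub_nonneg.2 hu.2) _)

theorem rlInt_const_mul {A α t : ℝ} (k : ℝ) (X : ℝ → ℝ) :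
    rlInt A α (fun u => k * X u) t = k * rlInt A α X t := by
  have h : ∀ u, (t - u) ^ (α - 1) * (k * X u) = k * ((t - u) ^ (α - 1) * X u) := fun u => by ring
  simp only [rlInt, h, intervalIntegral.integral_const_mul]
  ring

/-- The substitution `u = A + (t - A) v` frees the limits and the singular kernel from `t`, so that
dominated convergence yields continuity in `t`. -/
theorem rlInt_eq_rpow_mul_integral {A α t : ℝ} (X : ℝ → ℝ) (hα : 0 < α) (hAt : A ≤ t) :
    rlInt A α X t = (1 / Real.Gamma α) * ((t - A) ^ α *
      ∫ v in (0 : ℝ)..1, (1 - v) ^ (α - 1) * X (A + (t - A) * v)) := by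
  rw [rlInt]
  congr 1
  rcases hAt.eq_or_lt with rfl | hlt
  · simp [Real.zero_rpow hα.ne']
  have hpos := sub_pos.2 hlt
  have h := intervalIntegral.smul_integral_comp_add_mul
    (fun u => (t - u) ^ (α - 1) * X u) (t - A) A (a := 0) (b := 1)
  rw [show A + (t - A) * 0 = A by ring, show A + (t - A) * 1 = t by ring] at h
  rw [← h, smul_eq_mul, ← intervalIntegral.integral_const_mul,
    ← intervalIntegral.integral_const_mul]
  refine intervalIntegral.integral_congr fun v hv => ?_
  rw [uIcc_of_le zero_le_one] at hv
  rw [show t - (A + (t - A) * v) = (t - A) * (1 - v) by ring,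
    Real.mul_rpow hpos.le (by linarith [hv.2]), Real.rpow_sub_one hpos.ne']
  field_simp

theorem continuousOn_rlInt {A α : ℝ} {X : ℝ → ℝ} (hα : 0 < α) (hX : Continuous X) {M : ℝ}
    (hM : ∀ u, |X u| ≤ M) : ContinuousOn (rlInt A α X) (Ici A) := by
  have hc : Continuous fun t : ℝ => (1 / Real.Gamma α) * ((t - A) ^ α *
      ∫ v in (0 : ℝ)..1, (1 - v) ^ (α - 1) * X (A + (t - A) * v)) := by
    refine continuous_const.mul (Continuous.mul ?_ ?_)
    · exact (continuous_id.sub continuous_const).rpow_const fun _ => Or.inr hα.le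
    · refine intervalIntegral.continuous_of_dominated_interval
        (bound := fun v => (1 - v) ^ (α - 1) * M) ?_ ?_ ?_ ?_
      · intro t
        refine Measurable.aestronglyMeasurable ?_
        have := hX.measurable
        fun_prop
      · intro t
        refine Eventually.of_forall fun v hv => ?_
        rw [uIoc_of_le zero_le_one] at hv
        have h0 : 0 ≤ (1 - v) ^ (α - 1) := Real.rpow_nonneg (by linarith [hv.2]) _
        rw [norm_mul, Real.norm_of_nonneg h0]
        exact mul_le_mul_of_nonneg_left (hM _) h0
      · exact (intervalIntegrable_sub_rpow hα 0 1).mul_const M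
      · refine Eventually.of_forall fun v _ => ?_
        fun_prop
  refine hc.continuousOn.congr fun t ht => ?_
  exact rlInt_eq_rpow_mul_integral X hα ht

theorem rlInt_self (A α : ℝ) (X : ℝ → ℝ) : rlInt A α X A = 0 := by
  simp [rlInt]

/-! ### Fractional Gronwall inequality and injectivity -/

theorem rlInt_exp_le {A t μ r : ℝ} (hμ : 0 < μ) (hr : 0 < r) (hAt : A ≤ t) :
    rlInt A μ (fun u => Real.exp (r * (u - A))) t ≤ r ^ (-μ) * Real.exp (r * (t - A)) := by
  have hg := Real.Gamma_pos_of_pos hμ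
  have h1 : ∫ u in A..t, (t - u) ^ (μ - 1) * Real.exp (r * (u - A)) =
      Real.exp (r * (t - A)) * ∫ s in (0 : ℝ)..(t - A), s ^ (μ - 1) * Real.exp (-(r * s)) := by
    have h := intervalIntegral.integral_comp_sub_left
      (fun s : ℝ => s ^ (μ - 1) * Real.exp (-(r * s))) t (a := A) (b := t)
    rw [sub_self] at h
    rw [← h, ← intervalIntegral.integral_const_mul]
    refine intervalIntegral.integral_congr fun u _ => ?_
    rw [mul_left_comm, ← Real.exp_add]
    congr 2
    ring
  have h2 := Real.integral_rpow_mul_exp_neg_mul_Ioi hμ hr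
  have hi : IntegrableOn (fun s : ℝ => s ^ (μ - 1) * Real.exp (-(r * s))) (Ioi 0) := by
    by_contra h
    rw [integral_undef h] at h2
    have : 0 < (1 / r) ^ μ * Real.Gamma μ := by positivity
    linarith
  -- The integrand is nonnegative, so extending the range to `(0, ∞)` only increases the integral,
  -- which becomes a Gamma integral.
  have h3 : ∫ s in (0 : ℝ)..(t - A), s ^ (μ - 1) * Real.exp (-(r * s)) ≤
      (1 / r) ^ μ * Real.Gamma μ := by
    rw [← h2, intervalIntegral.integral_of_le (sub_nonneg.2 hAt)]
    refine setIntegral_mono_set hi ?_ (Ioc_subset_Ioi_self.eventuallyLE)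
    filter_upwards [ae_restrict_mem measurableSet_Ioi] with s hs
    exact mul_nonneg (Real.rpow_nonneg (le_of_lt hs) _) (Real.exp_pos _).le
  rw [rlInt, h1]
  calc 1 / Real.Gamma μ * (Real.exp (r * (t - A)) *
        ∫ s in (0 : ℝ)..(t - A), s ^ (μ - 1) * Real.exp (-(r * s)))
      ≤ 1 / Real.Gamma μ * (Real.exp (r * (t - A)) * ((1 / r) ^ μ * Real.Gamma μ)) := by gcongr
    _ = r ^ (-μ) * Real.exp (r * (t - A)) := by
        rw [one_div r, Real.inv_rpow hr.le, Real.rpow_neg hr.le]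
        field_simp

/-- A nonnegative continuous function dominated by a multiple of its own fractional integral
vanishes. -/
theorem eq_zero_of_le_mul_rlInt {A B μ L : ℝ} {w : ℝ → ℝ} (hAB : A ≤ B) (hμ : 0 < μ) (hL : 0 ≤ L)
    (hw : Continuous w) (hw0 : ∀ u, 0 ≤ w u) (h : ∀ t ∈ Icc A B, w t ≤ L * rlInt A μ w t) :
    ∀ t ∈ Icc A B, w t = 0 := by
  -- This choice gives `r ^ (-μ) = 1 / (L + 1)`. In the sup norm weighted by `exp (-r (u - A))`, the
  -- map `L * I^μ` then has factor at most `L / (L + 1) < 1`.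
  set r : ℝ := (L + 1) ^ (1 / μ) with hr
  have hr0 : 0 < r := Real.rpow_pos_of_pos (by linarith) _
  have hrμ : r ^ (-μ) = (L + 1)⁻¹ := by
    rw [hr, ← Real.rpow_mul (by linarith), show 1 / μ * -μ = -1 by field_simp, Real.rpow_neg_one]
  obtain ⟨τ, hτ, hmax⟩ := isCompact_Icc.exists_isMaxOn (nonempty_Icc.2 hAB)
    (f := fun u => w u * Real.exp (-(r * (u - A)))) (by fun_prop)
  set K := w τ * Real.exp (-(r * (τ - A))) with hK
  have hbound : ∀ u ∈ Icc A B, w u ≤ K * Real.exp (r * (u - A)) := by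
    intro u hu
    have h1 : w u * Real.exp (-(r * (u - A))) ≤ K := hmax hu
    calc w u = w u * Real.exp (-(r * (u - A))) * Real.exp (r * (u - A)) := by
          rw [mul_assoc, ← Real.exp_add]; simp
      _ ≤ _ := by gcongr
  have hK0 : 0 ≤ K := mul_nonneg (hw0 _) (Real.exp_pos _).le
  have h1 : w τ ≤ L * (K * ((L + 1)⁻¹ * Real.exp (r * (τ - A)))) := by
    refine (h τ hτ).trans (mul_le_mul_of_nonneg_left ?_ hL)
    refine (rlInt_mono hμ hτ.1 hw (Y := fun u => K * Real.exp (r * (u - A))) (by fun_prop)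
      fun u hu => hbound u ⟨hu.1, hu.2.trans hτ.2⟩).trans ?_
    rw [rlInt_const_mul, ← hrμ]
    exact mul_le_mul_of_nonneg_left (rlInt_exp_le hμ hr0 hτ.1) hK0
  have h2 : K ≤ L * (L + 1)⁻¹ * K := by
    calc K ≤ L * (K * ((L + 1)⁻¹ * Real.exp (r * (τ - A)))) * Real.exp (-(r * (τ - A))) := by
          rw [hK]; exact mul_le_mul_of_nonneg_right h1 (Real.exp_pos _).le
      _ = L * (L + 1)⁻¹ * K * (Real.exp (r * (τ - A)) * Real.exp (-(r * (τ - A)))) := by ring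
      _ = L * (L + 1)⁻¹ * K := by rw [← Real.exp_add]; simp
  have h3 : L * (L + 1)⁻¹ < 1 := by
    rw [← div_eq_mul_inv, div_lt_one (by linarith)]; linarith
  have h4 : K = 0 := by nlinarith
  intro t ht
  have := hbound t ht
  rw [h4, zero_mul] at this
  exact le_antisymm this (hw0 t)

/-- Differentiating the primitives gives equality on the open interval; continuity extends it to the
endpoints. -/
theorem eqOn_of_integral_eq {A B : ℝ} {X Z : ℝ → ℝ} (hAB : A < B) (hX : ContinuousOn X (Icc A B))
    (hZ : ContinuousOn Z (Icc A B))
    (h : ∀ t ∈ Icc A B, ∫ u in A..t, X u = ∫ u in A..t, Z u) : EqOn X Z (Icc A B) := by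
  have hd : ∀ Y : ℝ → ℝ, ContinuousOn Y (Icc A B) → ∀ t ∈ Ioo A B,
      HasDerivAt (fun s => ∫ u in A..s, Y u) (Y t) t := by
    intro Y hY t ht
    refine intervalIntegral.integral_hasDerivAt_right ?_ ?_ ?_
    · exact (hY.mono (Icc_subset_Icc_right ht.2.le)).intervalIntegrable_of_Icc ht.1.le
    · exact ContinuousOn.stronglyMeasurableAtFilter isOpen_Ioo (hY.mono Ioo_subset_Icc_self) t ht
    · exact hY.continuousAt (Icc_mem_nhds ht.1 ht.2)
  have hI : EqOn X Z (Ioo A B) := by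
    intro t ht
    refine (hd X hX t ht).unique ((hd Z hZ t ht).congr_of_eventuallyEq ?_)
    filter_upwards [Icc_mem_nhds ht.1 ht.2] with s hs using h s hs
  exact hI.of_subset_closure hX hZ Ioo_subset_Icc_self (closure_Ioo hAB.ne).ge

/-- Injectivity of the Riemann-Liouville integral of order `α < 1`. -/
theorem eqOn_rlInt_of_rlInt_eq {A B α μ M : ℝ} {X H : ℝ → ℝ} (hAB : A < B) (hα0 : 0 < α)
    (hα1 : α < 1) (hμ : 0 < μ) (hX : Continuous X) (hH : Continuous H) (hM : ∀ u, |H u| ≤ M)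
    (h : ∀ t ∈ Ioc A B, rlInt A α X t = rlInt A (α + μ) H t) :
    EqOn X (rlInt A μ H) (Icc A B) := by
  have hZ := continuousOn_rlInt (A := A) hμ hH hM
  refine eqOn_of_integral_eq hAB hX.continuousOn (hZ.mono Icc_subset_Ici_self) fun t ht => ?_
  -- Applying `I^{1-α}` to both sides reduces the claim to equality of the ordinary primitives of
  -- `X` and `I^μ H`.
  have h1 := rlInt_rlInt_of_continuous (sub_pos.2 hα1) hα0 ht.1 hX
  have h2 := rlInt_rlInt_of_continuous (sub_pos.2 hα1) (add_pos hα0 hμ) ht.1 hH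
  have h3 := rlInt_rlInt_of_continuous one_pos hμ ht.1 hH
  rw [rlInt_congr (fun u hu => h u ⟨hu.1, hu.2.trans ht.2⟩) ht.1, h2,
    show 1 - α + (α + μ) = 1 + μ by ring, ← h3, show 1 - α + α = 1 by ring, rlInt_one,
    rlInt_one] at h1
  exact h1.symm

/-! ### The substitution `u = Ψ(s)` -/

theorem strictMonoOn_of_derivWithin_ne_zero {a b : ℝ} {Ψ : ℝ → ℝ} (hc : ContinuousOn Ψ (Icc a b))
    (hm : MonotoneOn Ψ (Icc a b)) (h' : ∀ t ∈ Icc a b, derivWithin Ψ (Icc a b) t ≠ 0) :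
    StrictMonoOn Ψ (Icc a b) := by
  refine strictMonoOn_of_deriv_pos (convex_Icc a b) hc fun t ht => ?_
  rw [interior_Icc] at ht
  rw [← derivWithin_of_mem_nhds (Icc_mem_nhds ht.1 ht.2)]
  exact lt_of_le_of_ne hm.derivWithin_nonneg (h' t (Ioo_subset_Icc_self ht)).symm

/-- The inverse of `Ψ` is extended by its endpoint values, so that `x ∘ φ` is continuous on the
whole line whenever `x` is. -/
theorem exists_continuous_inverse {a b : ℝ} {Ψ : ℝ → ℝ} (hab : a ≤ b)
    (hc : ContinuousOn Ψ (Icc a b)) (hm : StrictMonoOn Ψ (Icc a b)) :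
    ∃ φ : ℝ → ℝ, Continuous φ ∧ (∀ t ∈ Icc a b, φ (Ψ t) = t) ∧
      ∀ u ∈ Icc (Ψ a) (Ψ b), φ u ∈ Icc a b ∧ Ψ (φ u) = u := by
  have hmem : ∀ t ∈ Icc a b, Ψ t ∈ Icc (Ψ a) (Ψ b) := fun t ht =>
    ⟨hm.monotoneOn (left_mem_Icc.2 hab) ht ht.1, hm.monotoneOn ht (right_mem_Icc.2 hab) ht.2⟩
  have hAB : Ψ a ≤ Ψ b := (hmem b (right_mem_Icc.2 hab)).1
  let g : Icc a b → Icc (Ψ a) (Ψ b) := fun t => ⟨Ψ t, hmem t t.2⟩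
  have hg : StrictMono g := fun s t hst => hm s.2 t.2 hst
  have hgs : Function.Surjective g := by
    rintro ⟨u, hu⟩
    obtain ⟨t, ht, rfl⟩ := intermediate_value_Icc hab hc hu
    exact ⟨⟨t, ht⟩, rfl⟩
  let e := hg.orderIsoOfSurjective g hgs
  refine ⟨IccExtend hAB fun u => ((e.symm u : Icc a b) : ℝ),
    (continuous_subtype_val.comp e.symm.continuous).Icc_extend', fun t ht => ?_, fun u hu => ?_⟩
  · rw [IccExtend_of_mem _ _ (hmem t ht)]
    have : e ⟨t, ht⟩ = ⟨Ψ t, hmem t ht⟩ := rfl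
    rw [← this, e.symm_apply_apply]
  · rw [IccExtend_of_mem _ _ hu]
    exact ⟨(e.symm ⟨u, hu⟩).2, congrArg Subtype.val (e.apply_symm_apply ⟨u, hu⟩)⟩

section Transfer

variable {a b : ℝ} {Ψ : ℝ → ℝ}

theorem hasDerivAt_of_mem_Ioo (hd : DifferentiableOn ℝ Ψ (Icc a b)) {s : ℝ} (hs : s ∈ Ioo a b) :
    HasDerivAt Ψ (derivWithin Ψ (Icc a b) s) s :=
  (hd s (Ioo_subset_Icc_self hs)).hasDerivWithinAt.hasDerivAt (Icc_mem_nhds hs.1 hs.2)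

/-- Monotonicity of `Ψ` makes the substitution valid for arbitrary `F`, which accommodates singular
kernels. -/
theorem integral_derivWithin_mul_comp (hd : DifferentiableOn ℝ Ψ (Icc a b))
    (hm : MonotoneOn Ψ (Icc a b)) {t : ℝ} (ht : t ∈ Icc a b) (F : ℝ → ℝ) :
    ∫ s in a..t, derivWithin Ψ (Icc a b) s * F (Ψ s) = ∫ u in Ψ a..Ψ t, F u := by
  rw [intervalIntegral.integral_of_le ht.1, intervalIntegral.integral_of_le
    (hm (left_mem_Icc.2 (ht.1.trans ht.2)) ht ht.1), ← integral_Icc_eq_integral_Ioc,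
    ← integral_Icc_eq_integral_Ioc]
  exact integral_Icc_deriv_smul_of_deriv_nonneg (hd.continuousOn.mono (Icc_subset_Icc_right ht.2))
    (fun s hs => hasDerivAt_of_mem_Ioo hd ⟨hs.1, hs.2.trans_le ht.2⟩)
    (fun s _ => hm.derivWithin_nonneg) ht.1

theorem intervalIntegrable_derivWithin_mul_comp_iff (hd : DifferentiableOn ℝ Ψ (Icc a b))
    (hm : MonotoneOn Ψ (Icc a b)) {t : ℝ} (ht : t ∈ Icc a b) (F : ℝ → ℝ) :
    IntervalIntegrable (fun s => derivWithin Ψ (Icc a b) s * F (Ψ s)) volume a t ↔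
      IntervalIntegrable F volume (Ψ a) (Ψ t) := by
  rw [intervalIntegrable_iff_integrableOn_Icc_of_le ht.1,
    intervalIntegrable_iff_integrableOn_Icc_of_le
      (hm (left_mem_Icc.2 (ht.1.trans ht.2)) ht ht.1)]
  exact integrableOn_Icc_deriv_smul_iff_of_deriv_nonneg
    (hd.continuousOn.mono (Icc_subset_Icc_right ht.2))
    (fun s hs => hasDerivAt_of_mem_Ioo hd ⟨hs.1, hs.2.trans_le ht.2⟩)
    (fun s _ => hm.derivWithin_nonneg) ht.1

variable {φ : ℝ → ℝ}

theorem mem_Ioc_of_mem_Ioc (hφ' : ∀ u ∈ Icc (Ψ a) (Ψ b), φ u ∈ Icc a b ∧ Ψ (φ u) = u) {u : ℝ}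
    (hu : u ∈ Ioc (Ψ a) (Ψ b)) : φ u ∈ Ioc a b ∧ Ψ (φ u) = u := by
  obtain ⟨h1, h2⟩ := hφ' u (Ioc_subset_Icc_self hu)
  refine ⟨⟨lt_of_le_of_ne h1.1 fun hau => ?_, h1.2⟩, h2⟩
  have := hu.1
  rw [← h2, ← hau] at this
  exact lt_irrefl _ this

theorem kernel_mul_eq (hφ : ∀ t ∈ Icc a b, φ (Ψ t) = t) (α t : ℝ) (x : ℝ → ℝ) {s : ℝ}
    (hs : s ∈ Icc a b) : kernel a b Ψ α t s * x s =
      derivWithin Ψ (Icc a b) s * ((Ψ t - Ψ s) ^ (α - 1) * x (φ (Ψ s))) := by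
  rw [kernel, hφ s hs, mul_assoc]

theorem fracInt_eq_rlInt (hd : DifferentiableOn ℝ Ψ (Icc a b)) (hm : MonotoneOn Ψ (Icc a b))
    (hφ : ∀ t ∈ Icc a b, φ (Ψ t) = t) {α t : ℝ} (hα : α ≠ 0) (ht : t ∈ Icc a b) (x : ℝ → ℝ) :
    fracInt a b Ψ α x t = rlInt (Ψ a) α (x ∘ φ) (Ψ t) := by
  rw [fracInt, if_neg hα, rlInt]
  congr 1
  rw [← integral_derivWithin_mul_comp hd hm ht fun u => (Ψ t - u) ^ (α - 1) * (x ∘ φ) u]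
  refine intervalIntegral.integral_congr fun s hs => ?_
  rw [uIcc_of_le ht.1] at hs
  exact kernel_mul_eq hφ α t x ⟨hs.1, hs.2.trans ht.2⟩

theorem intervalIntegrable_of_fracIntegrable (hd : DifferentiableOn ℝ Ψ (Icc a b))
    (hm : MonotoneOn Ψ (Icc a b)) (hφ : ∀ t ∈ Icc a b, φ (Ψ t) = t) {α t : ℝ} (hα : α ≠ 0)
    (ht : t ∈ Icc a b) {x : ℝ → ℝ} (h : FracIntegrable a b Ψ α x t) :
    IntervalIntegrable (fun u => (Ψ t - u) ^ (α - 1) * (x ∘ φ) u) volume (Ψ a) (Ψ t) := by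
  rw [← intervalIntegrable_derivWithin_mul_comp_iff hd hm ht]
  refine (h hα).congr fun s hs => ?_
  rw [uIoc_of_le ht.1] at hs
  exact kernel_mul_eq hφ α t x ⟨hs.1.le, hs.2.trans ht.2⟩

/-- If `I^{β;Ψ} g = h` on `(a,b]`, then `I^{1;Ψ} g = I^{1-β;Ψ} h`. -/
theorem integral_derivWithin_mul_eq_rlInt (hd : DifferentiableOn ℝ Ψ (Icc a b))
    (hm : StrictMonoOn Ψ (Icc a b)) (hφ : ∀ t ∈ Icc a b, φ (Ψ t) = t) (hφc : Continuous φ)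
    (hφ' : ∀ u ∈ Icc (Ψ a) (Ψ b), φ u ∈ Icc a b ∧ Ψ (φ u) = u) {β : ℝ} (hβ0 : 0 ≤ β) (hβ1 : β < 1)
    {g h : ℝ → ℝ} (hh : Continuous h) (hg : ∀ t ∈ Ioc a b, FracIntegrable a b Ψ β g t)
    (hgh : ∀ t ∈ Ioc a b, fracInt a b Ψ β g t = h t) {t : ℝ} (ht : t ∈ Ioc a b) :
    IntervalIntegrable (fun s => derivWithin Ψ (Icc a b) s * g s) volume a t ∧
      ∫ s in a..t, derivWithin Ψ (Icc a b) s * g s =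
        rlInt (Ψ a) (1 - β) (h ∘ φ) (Ψ t) := by
  have htc := Ioc_subset_Icc_self ht
  have hab : a < b := ht.1.trans_le ht.2
  have hA := left_mem_Icc.2 hab.le
  have hAt : Ψ a ≤ Ψ t := hm.monotoneOn hA htc ht.1.le
  have hφm : ∀ u ∈ Ioc (Ψ a) (Ψ t), φ u ∈ Ioc a b := fun u hu =>
    (mem_Ioc_of_mem_Ioc hφ'
      ⟨hu.1, hu.2.trans (hm.monotoneOn htc (right_mem_Icc.2 hab.le) ht.2)⟩).1
  have hφe : ∀ u ∈ Ioc (Ψ a) (Ψ t), Ψ (φ u) = u := fun u hu =>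
    (hφ' u ⟨hu.1.le, hu.2.trans (hm.monotoneOn htc (right_mem_Icc.2 hab.le) ht.2)⟩).2
  have key : IntervalIntegrable (g ∘ φ) volume (Ψ a) (Ψ t) ∧
      rlInt (Ψ a) 1 (g ∘ φ) (Ψ t) = rlInt (Ψ a) (1 - β) (h ∘ φ) (Ψ t) := by
    rcases hβ0.eq_or_lt with rfl | hβ
    · have he : ∀ u ∈ Ioc (Ψ a) (Ψ t), (g ∘ φ) u = (h ∘ φ) u := fun u hu => by
        simpa [fracInt] using hgh _ (hφm u hu)
      constructor
      · refine ((hh.comp hφc).intervalIntegrable (Ψ a) (Ψ t)).congr fun u hu => ?_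
        rw [uIoc_of_le hAt] at hu
        exact (he u hu).symm
      · rw [sub_zero]
        exact rlInt_congr he hAt
    -- Absolute convergence of `I^β g` at `t` makes `g ∘ φ` itself integrable. This is what the
    -- semigroup law requires, since the combined kernel has exponent `(1-β)+β-1 = 0`.
    · have hi : IntervalIntegrable (g ∘ φ) volume (Ψ a) (Ψ t) :=
        intervalIntegrable_of_sub_rpow_mul hβ1.le hAt
          (intervalIntegrable_of_fracIntegrable hd hm.monotoneOn hφ hβ.ne' htc (hg t ht))
      refine ⟨hi, ?_⟩
      have hs := rlInt_rlInt (A := Ψ a) (t := Ψ t) (X := g ∘ φ) (sub_pos.2 hβ1) hβ hAt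
        ((intervalIntegrable_iff_integrableOn_Ioc_of_le hAt).1 hi).aestronglyMeasurable
        (by simpa [Function.comp_def] using hi)
      rw [sub_add_cancel] at hs
      rw [← hs]
      refine rlInt_congr (fun u hu => ?_) hAt
      have h1 := fracInt_eq_rlInt hd hm.monotoneOn hφ hβ.ne' (Ioc_subset_Icc_self (hφm u hu)) g
      rw [hφe u hu, hgh _ (hφm u hu)] at h1
      exact h1.symm
  constructor
  · refine ((intervalIntegrable_derivWithin_mul_comp_iff hd hm.monotoneOn htc _).2 key.1).congr
      fun s hs => ?_
    rw [uIoc_of_le ht.1.le] at hs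
    simp only [Function.comp_apply]
    rw [hφ s ⟨hs.1.le, hs.2.trans ht.2⟩]
  · rw [← key.2, rlInt_one, ← integral_derivWithin_mul_comp hd hm.monotoneOn htc]
    refine intervalIntegral.integral_congr fun s hs => ?_
    rw [uIcc_of_le ht.1.le] at hs
    simp only [Function.comp_apply]
    rw [hφ s ⟨hs.1, hs.2.trans ht.2⟩]

/-! ### From the differential equation to the integral equation -/

theorem integral_derivWithin_mul_psiDeriv (h' : ∀ t ∈ Icc a b, derivWithin Ψ (Icc a b) t ≠ 0)
    {y : ℝ → ℝ} {c : ℝ} (hy : ∀ t ∈ Ioc a b, DifferentiableWithinAt ℝ y (Icc a b) t)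
    (hc : Tendsto y (𝓝[>] a) (𝓝 c)) {t : ℝ} (ht : t ∈ Ioc a b)
    (hi : IntervalIntegrable (fun s => derivWithin Ψ (Icc a b) s * psiDeriv a b Ψ y s) volume a t) :
    ∫ s in a..t, derivWithin Ψ (Icc a b) s * psiDeriv a b Ψ y s = y t - c := by
  have he : ∀ s ∈ Icc a b, derivWithin Ψ (Icc a b) s * psiDeriv a b Ψ y s =
      derivWithin y (Icc a b) s := by
    intro s hs
    rw [psiDeriv]
    field_simp [h' s hs]
  -- Differentiability is known only on `(a, b]`, so the fundamental theorem is used with the right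
  -- limit `c` in place of `y a`.
  refine intervalIntegral.integral_eq_sub_of_hasDerivAt_of_tendsto ht.1 (fun s hs => ?_) hi hc ?_
  · have hs' : s ∈ Ioo a b := ⟨hs.1, hs.2.trans_le ht.2⟩
    rw [he s (Ioo_subset_Icc_self hs')]
    exact (hy s (Ioo_subset_Ioc_self hs')).hasDerivWithinAt.hasDerivAt (Icc_mem_nhds hs'.1 hs'.2)
  · have h1 : Tendsto y (𝓝[Icc a b] t) (𝓝 (y t)) := (hy t ht).continuousWithinAt
    refine h1.mono_left (nhdsWithin_le_iff.2 ?_)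
    filter_upwards [Ioo_mem_nhdsLT ht.1] with s hs using ⟨hs.1.le, hs.2.le.trans ht.2⟩

/-- The fractional integral equation equivalent to the initial value problem. -/
theorem eq_add_rlInt_of_hilferDeriv_eq (hab : a < b) (hd : DifferentiableOn ℝ Ψ (Icc a b))
    (hm : StrictMonoOn Ψ (Icc a b)) (h' : ∀ t ∈ Icc a b, derivWithin Ψ (Icc a b) t ≠ 0)
    (hφ : ∀ t ∈ Icc a b, φ (Ψ t) = t) (hφc : Continuous φ)
    (hφ' : ∀ u ∈ Icc (Ψ a) (Ψ b), φ u ∈ Icc a b ∧ Ψ (φ u) = u) {μ ν c Mx Mh : ℝ}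
    (hμ0 : 0 < μ) (hμ1 : μ ≤ 1) (hν0 : 0 ≤ ν) (hν1 : ν ≤ 1) {x h : ℝ → ℝ} (hx : Continuous x)
    (hxM : ∀ t, |x t| ≤ Mx) (hh : Continuous h) (hhM : ∀ t, |h t| ≤ Mh)
    (hxd : HilferDifferentiable a b Ψ μ ν x) (hxh : ∀ t ∈ Ioc a b, hilferDeriv a b Ψ μ ν x t = h t)
    (hc : Tendsto (fracInt a b Ψ (1 - (μ + ν * (1 - μ))) x) (𝓝[>] a) (𝓝 c)) :
    ∀ u ∈ Icc (Ψ a) (Ψ b), (x ∘ φ) u = c + rlInt (Ψ a) μ (h ∘ φ) u := by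
  have hα : 1 - (μ + ν * (1 - μ)) = (1 - ν) * (1 - μ) := by ring
  have hαβ : 1 - ν * (1 - μ) = (1 - ν) * (1 - μ) + μ := by ring
  rw [hα] at hc
  have hα0 : 0 ≤ (1 - ν) * (1 - μ) := mul_nonneg (by linarith) (by linarith)
  have hβ0 : 0 ≤ ν * (1 - μ) := mul_nonneg hν0 (by linarith)
  have hA := left_mem_Icc.2 hab.le
  have hAB : Ψ a < Ψ b := hm hA (right_mem_Icc.2 hab.le) hab
  have hφa : φ (Ψ a) = a := hφ a hA
  have hy : ∀ t ∈ Ioc a b, fracInt a b Ψ ((1 - ν) * (1 - μ)) x t =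
      c + rlInt (Ψ a) ((1 - ν) * (1 - μ) + μ) (h ∘ φ) (Ψ t) := by
    intro t ht
    obtain ⟨hi, he⟩ := integral_derivWithin_mul_eq_rlInt hd hm hφ hφc hφ' hβ0 (by linarith) hh
      hxd.outer_integrable hxh ht
    rw [integral_derivWithin_mul_psiDeriv h' hxd.inner_differentiable hc ht hi, hαβ] at he
    linarith
  have hφm : ∀ u ∈ Ioc (Ψ a) (Ψ b), φ u ∈ Ioc a b ∧ Ψ (φ u) = u := fun u hu =>
    mem_Ioc_of_mem_Ioc hφ' hu
  rcases hα0.eq_or_lt with h0 | h0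
  · rw [← h0] at hc hy
    have hc' : x a = c := by
      refine tendsto_nhds_unique ?_ hc
      have : fracInt a b Ψ 0 x = x := by funext t; simp [fracInt]
      rw [this]
      exact (hx.tendsto a).mono_left nhdsWithin_le_nhds
    intro u hu
    rcases hu.1.eq_or_lt with rfl | hu1
    · rw [rlInt_self, add_zero, Function.comp_apply, hφa, hc']
    · obtain ⟨h1, h2⟩ := hφm u ⟨hu1, hu.2⟩
      have h3 := hy _ h1
      rw [h2, zero_add] at h3
      simpa [fracInt] using h3
  · have hX : Continuous (x ∘ φ) := hx.comp hφc
    have hyX : ∀ t ∈ Icc a b, fracInt a b Ψ ((1 - ν) * (1 - μ)) x t =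
        rlInt (Ψ a) ((1 - ν) * (1 - μ)) (x ∘ φ) (Ψ t) := fun t ht =>
      fracInt_eq_rlInt hd hm.monotoneOn hφ h0.ne' ht x
    -- For `α > 0` the integral `I^α x` of a bounded function vanishes in the limit at `a`.
    have hc' : c = 0 := by
      refine tendsto_nhds_unique hc ?_
      have h1 : ContinuousWithinAt (fun t => rlInt (Ψ a) ((1 - ν) * (1 - μ)) (x ∘ φ) (Ψ t))
          (Icc a b) a :=
        (continuousOn_rlInt h0 hX fun u => hxM (φ u)).comp hd.continuousOn
          (fun t ht => hm.monotoneOn hA ht ht.1) a hA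
      have h2 : Tendsto (fun t => rlInt (Ψ a) ((1 - ν) * (1 - μ)) (x ∘ φ) (Ψ t)) (𝓝[Icc a b] a)
          (𝓝 0) := by
        have := h1.tendsto
        rwa [rlInt_self] at this
      refine (h2.mono_left (nhdsWithin_le_iff.2 ?_)).congr' ?_
      · filter_upwards [Ioo_mem_nhdsGT hab] with s hs using Ioo_subset_Icc_self hs
      · filter_upwards [Ioo_mem_nhdsGT hab] with s hs
        exact (hyX s (Ioo_subset_Icc_self hs)).symm
    intro u hu
    rw [hc', zero_add]
    refine eqOn_rlInt_of_rlInt_eq hAB h0 (by linarith) hμ0 hX (hh.comp hφc)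
      (fun u => hhM (φ u)) (fun v hv => ?_) hu
    obtain ⟨h1, h2⟩ := hφm v hv
    rw [← h2, ← hyX _ (Ioc_subset_Icc_self h1), hy _ h1, hc', zero_add]

end Transfer

/-! ### Comparison of solutions of the integral equation -/

theorem exists_abs_IccExtend_le {a b : ℝ} (hab : a ≤ b) {g : Icc a b → ℝ} (hg : Continuous g) :
    ∃ M, ∀ t, |IccExtend hab g t| ≤ M := by
  obtain ⟨M, hM⟩ := isCompact_univ.exists_bound_of_continuousOn hg.continuousOn
  exact ⟨M, fun t => hM _ (mem_univ _)⟩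

section Comparison

variable {a b ξ μ : ℝ} {Ψ : ℝ → ℝ}

/-- The pointwise maximum of two elements of the Bielecki space. -/
def bieleckiSup (x y : BieleckiSpace a b ξ μ Ψ) : BieleckiSpace a b ξ μ Ψ :=
  ⟨x.1 ⊔ y.1, by
    obtain ⟨B, hB⟩ := x.2
    obtain ⟨C, hC⟩ := y.2
    refine ⟨max B C, ?_⟩
    rintro _ ⟨t, rfl⟩
    have hBt := hB ⟨t, rfl⟩
    have hCt := hC ⟨t, rfl⟩
    simp only [ContinuousMap.sup_apply] at hBt hCt ⊢
    rcases max_choice (x.1 t) (y.1 t) with h | h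
    · rw [h]; exact hBt.trans (le_max_left _ _)
    · rw [h]; exact hCt.trans (le_max_right _ _)⟩

theorem bieleckiSup_apply (x y : BieleckiSpace a b ξ μ Ψ) (t : Icc a b) :
    (bieleckiSup x y).1 t = max (x.1 t) (y.1 t) := rfl

/-- One-sided Lipschitz estimate for an increasing Lipschitz right-hand side. -/
theorem sub_le_mul_max_of_monotone {f : Icc a b → ℝ → ℝ}
    {U : BieleckiSpace a b ξ μ Ψ → BieleckiSpace a b ξ μ Ψ} {LU Lf : ℝ}
    (hf : ∀ t u v, |f t u - f t v| ≤ Lf * |u - v|)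
    (hU : ∀ x y t, |(U x).1 t - (U y).1 t| ≤ LU * |x.1 t - y.1 t|)
    (hfm : ∀ t, Monotone (f t)) (hUm : Monotone U) (x y : BieleckiSpace a b ξ μ Ψ) (t : Icc a b) :
    ((U x).1 t + f t (x.1 t)) - ((U y).1 t + f t (y.1 t)) ≤
      (LU + Lf) * max (x.1 t - y.1 t) 0 := by
  have hz : |max (x.1 t) (y.1 t) - y.1 t| = max (x.1 t - y.1 t) 0 := by
    rw [← max_sub_sub_right, sub_self, abs_of_nonneg (le_max_right _ _)]
  -- Since `x` and `y` need not be ordered, the estimate passes through `z = max x y`: monotonicity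
  -- bounds the value at `x` by that at `z`, and the Lipschitz bounds apply to `z - y`, the positive
  -- part of `x - y`.
  have hxz : x ≤ bieleckiSup x y := fun s => le_max_left (x.1 s) (y.1 s)
  have h1 : (U x).1 t ≤ (U (bieleckiSup x y)).1 t := hUm hxz t
  have h2 := (le_abs_self _).trans (hU (bieleckiSup x y) y t)
  have h3 := hfm t (le_max_left (x.1 t) (y.1 t))
  have h4 := (le_abs_self _).trans (hf t (max (x.1 t) (y.1 t)) (y.1 t))
  rw [bieleckiSup_apply, hz] at h2
  rw [hz] at h4
  linarith

theorem continuous_rhs {f : Icc a b → ℝ → ℝ} (hf : Continuous fun p : Icc a b × ℝ => f p.1 p.2)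
    (y x : BieleckiSpace a b ξ μ Ψ) : Continuous fun t => y.1 t + f t (x.1 t) :=
  y.1.continuous.add (hf.comp (continuous_id.prodMk x.1.continuous))

theorem le_of_eq_add_rlInt {φ : ℝ → ℝ} {A B c d L : ℝ} {x y h k : ℝ → ℝ} (hAB : A ≤ B)
    (hμ : 0 < μ) (hL : 0 ≤ L) (hx : Continuous x) (hy : Continuous y) (hh : Continuous h)
    (hk : Continuous k) (hφ : Continuous φ)
    (hx' : ∀ u ∈ Icc A B, (x ∘ φ) u = c + rlInt A μ (h ∘ φ) u)
    (hy' : ∀ u ∈ Icc A B, (y ∘ φ) u = d + rlInt A μ (k ∘ φ) u) (hcd : c ≤ d)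
    (hhk : ∀ t, h t - k t ≤ L * max (x t - y t) 0) :
    ∀ u ∈ Icc A B, x (φ u) ≤ y (φ u) := by
  set w : ℝ → ℝ := fun u => max (x (φ u) - y (φ u)) 0 with hw
  have hwc : Continuous w := by fun_prop
  have hw0 : ∀ u, 0 ≤ w u := fun u => le_max_right _ _
  have h0 := eq_zero_of_le_mul_rlInt hAB hμ hL hwc hw0 fun u hu => by
    rw [← rlInt_const_mul]
    refine max_le ?_ ?_
    · have h1 := rlInt_mono hμ hu.1 (X := fun v => (h ∘ φ) v - (k ∘ φ) v)
        (Y := fun v => L * w v) ((hh.comp hφ).sub (hk.comp hφ)) (by fun_prop)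
        fun v _ => hhk (φ v)
      rw [rlInt_sub hμ (hh.comp hφ) (hk.comp hφ)] at h1
      have h2 := hx' u hu
      have h3 := hy' u hu
      simp only [Function.comp_apply] at h2 h3
      rw [h2, h3]
      linarith
    -- Zero is written as `0 * 0` so that `rlInt_const_mul` evaluates its integral.
    · have h1 := rlInt_mono hμ hu.1 (X := fun _ => (0 : ℝ) * 0) (Y := fun v => L * w v)
        (by fun_prop) (by fun_prop) fun v _ => by
          rw [zero_mul]
          exact mul_nonneg hL (hw0 v)
      rwa [rlInt_const_mul, zero_mul] at h1
  intro u hu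
  have h1 : x (φ u) - y (φ u) ≤ w u := le_max_left _ _
  rw [h0 u hu] at h1
  linarith

end Comparison

end PsiHilfer

end

/-! ### The comparison theorem -/

theorem theoremt4 (a b μ ν ξ : ℝ) (hab : a < b)
    (hμ0 : 0 < μ) (hμ1 : μ ≤ 1) (hν0 : 0 ≤ ν) (hν1 : ν ≤ 1) (hξ : 0 < ξ)
    (Ψ : ℝ → ℝ) (hΨC : ContDiffOn ℝ 1 Ψ (Icc a b)) (hΨmono : MonotoneOn Ψ (Icc a b))
    (hΨ' : ∀ t ∈ Icc a b, derivWithin Ψ (Icc a b) t ≠ 0)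
    (f : Fin 3 → Icc a b → ℝ → ℝ)
    (U : Fin 3 → PsiHilfer.BieleckiSpace a b ξ μ Ψ → PsiHilfer.BieleckiSpace a b ξ μ Ψ)
    (hf : ∀ i, Continuous (fun p : Icc a b × ℝ => f i p.1 p.2))
    (hLip : ∀ i, PsiHilfer.LipschitzConditions (f i) (U i))
    (hf12 : ∀ t u, f 0 t u ≤ f 1 t u) (hf23 : ∀ t u, f 1 t u ≤ f 2 t u)
    (hU12 : ∀ x t, (U 0 x).1 t ≤ (U 1 x).1 t) (hU23 : ∀ x t, (U 1 x).1 t ≤ (U 2 x).1 t)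
    (hfmono : ∀ t, Monotone (f 1 t)) (hUmono : Monotone (U 1))
    (x : Fin 3 → PsiHilfer.BieleckiSpace a b ξ μ Ψ)
    (hx : ∀ i, PsiHilfer.IsSolution hab.le ν (f i) (U i) (x i))
    (c : Fin 3 → ℝ) (hc : ∀ i, PsiHilfer.HasInitialValue hab.le ν (x i) (c i))
    (hc12 : c 0 ≤ c 1) (hc23 : c 1 ≤ c 2) :
    (∀ t, (x 0).1 t ≤ (x 1).1 t) ∧ (∀ t, (x 1).1 t ≤ (x 2).1 t) := by
  have hd : DifferentiableOn ℝ Ψ (Icc a b) := hΨC.differentiableOn one_ne_zero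
  have hm := PsiHilfer.strictMonoOn_of_derivWithin_ne_zero hΨC.continuousOn hΨmono hΨ'
  obtain ⟨φ, hφc, hφ, hφ'⟩ :=
    PsiHilfer.exists_continuous_inverse hab.le hΨC.continuousOn hm
  have hmem : ∀ t : Icc a b, Ψ t ∈ Icc (Ψ a) (Ψ b) := fun t =>
    ⟨hΨmono (left_mem_Icc.2 hab.le) t.2 t.2.1, hΨmono t.2 (right_mem_Icc.2 hab.le) t.2.2⟩
  have hAB : Ψ a ≤ Ψ b := hΨmono (left_mem_Icc.2 hab.le) (right_mem_Icc.2 hab.le) hab.le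
  have hxc : ∀ i, Continuous (IccExtend hab.le (x i).1) := fun i =>
    (x i).1.continuous.Icc_extend'
  have hrc : ∀ i, Continuous fun t => (U i (x i)).1 t + f i t ((x i).1 t) := fun i =>
    PsiHilfer.continuous_rhs (hf i) _ _
  have hrep : ∀ i, ∀ u ∈ Icc (Ψ a) (Ψ b), (IccExtend hab.le (x i).1 ∘ φ) u = c i +
      PsiHilfer.rlInt (Ψ a) μ
        (IccExtend hab.le (fun t => (U i (x i)).1 t + f i t ((x i).1 t)) ∘ φ) u := by
    intro i
    obtain ⟨Mx, hMx⟩ := PsiHilfer.exists_abs_IccExtend_le hab.le (x i).1.continuous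
    obtain ⟨Mh, hMh⟩ := PsiHilfer.exists_abs_IccExtend_le hab.le (hrc i)
    refine PsiHilfer.eq_add_rlInt_of_hilferDeriv_eq hab hd hm hΨ' hφ hφc hφ' hμ0 hμ1 hν0 hν1
      (hxc i) hMx (hrc i).Icc_extend' hMh (hx i).1 (fun t ht => ?_) (hc i)
    rw [IccExtend_of_mem _ _ (Ioc_subset_Icc_self ht)]
    exact (hx i).2 ⟨t, Ioc_subset_Icc_self ht⟩ ht.1
  obtain ⟨-, Lf, hLf, LU, hLU, -, hfL, hUL⟩ := hLip 1
  have hone := PsiHilfer.sub_le_mul_max_of_monotone hfL hUL hfmono hUmono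
  have hle : ∀ i j, c i ≤ c j →
      (∀ t, ((U i (x i)).1 t + f i t ((x i).1 t)) - ((U j (x j)).1 t + f j t ((x j).1 t)) ≤
        (LU + Lf) * max ((x i).1 t - (x j).1 t) 0) → ∀ t, (x i).1 t ≤ (x j).1 t := by
    intro i j hcij hij t
    have h := PsiHilfer.le_of_eq_add_rlInt hAB hμ0 (add_pos hLU hLf).le (hxc i) (hxc j)
      (hrc i).Icc_extend' (hrc j).Icc_extend' hφc (hrep i) (hrep j) hcij
      (fun s => hij (projIcc a b hab.le s)) (Ψ t) (hmem t)
    rwa [hφ t t.2, IccExtend_val, IccExtend_val] at h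
  -- Each outer right-hand side is compared with the middle one along the outer solution, `x 0` or
  -- `x 2`; the one-sided estimate for the middle one does the rest.
  refine ⟨hle 0 1 hc12 fun t => ?_, hle 1 2 hc23 fun t => ?_⟩
  · linarith [hone (x 0) (x 1) t, hU12 (x 0) t, hf12 t ((x 0).1 t)]
  · linarith [hone (x 1) (x 2) t, hU23 (x 2) t, hf23 t ((x 2).1 t)]
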